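/- Setting. The plane is $\mathbb{R}^2\cong\mathbb{C}$. A local tree topology $T$ is a finite tree with nodes $0,\dots,n$ in which every edge has a fixed direction that is a multiple of $60^\circ$ and a length that is one of finitely many parameters $w_i$ or the normalized value $1$; its nodes are regular points or boundary nodes, which are leaves, and Steiner points, which have degree three with edges at $120^\circ$. Let $\mathcal W=\{w: w_i\ge 0\}$, and let $p_x(w)$ be the position of the node $x$, with node $0$ at the origin. A configuration over $w$ is a Steiner minimal tree $S$ of a finite set $V$ of regular points, with all regular points of degree $1$ and all Steiner points of degree $3$, that contains $T$ with edge lengths $w$ (the nodes at distinct positions $p_x(w)$, the regular nodes of $T$ in $V$, the Steiner nodes of $T$ not in $V$, a boundary node being of either kind). An implicit regular point is a point of $V$ that is not a regular node of $T$. A splitting $\tau=(V^*,S^-,S^+,t^*)$ consists of a set $V^*$ of nodes, a set $S^-$ of edges of $T$, a graph $S^+$ on nodes of $T$ and finitely many auxiliary vertices, and a graph $t^*$ on nodes of $T$ and possibly one implicit regular point $v_0$. It is admissible for a configuration (and a choice of $v_0$) if $\emptyset\neq V^*\subsetneq V$; no point of $V^*$ is incident to $S\setminus S^-$; $t^*$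 is a forest with vertices in $V$ that connects every point of $V^*$ to some point of $V\setminus V^*$ and connects no two distinct points of $V\setminus V^*$; and $(S\setminus S^-)\cup S^+$ is a tree containing $V\setminus V^*$. For a constant $\rho\ge0$ the splitting function is $F_\tau=\rho L_{t^*}+L_{S^+}-L_{S^-}$, where $L$ denotes total Euclidean edge length and the auxiliary vertices of $S^+$ are placed so as to minimize $L_{S^+}$; $F_\tau=+\infty$ where $\tau$ is not admissible. A function $f:\mathcal W\to\mathbb R\cup\{+\infty\}$ is a verification function if (shape) its restriction to every axis-parallel line (within $\mathcal W$) is first non-increasing and then non-decreasing, either phase possibly being empty, and (bounding) there is a splitting $\tau$, with a choice of $v_0$ in each configuration, such that $F_\tau\le f(w)$ for every $w\in\mathcal W$ and every configuration over $w$. Theorem. Let $T$ be a local tree topology, $\rho\ge 0$, and $\tau$ a splitting. 1. (Trapped Regular Point Lemma.) Let $\Omega$ be the solution set of finitely many weak or strict linear inequalities in $w$, and let $P_0(w),\dots,P_m(w)$ be points of the plane that depend affinely on $w$. Suppose that for all $w\in\mathcal W\cap\Omega$ every configuration over $w$ has an implicit regular point in the polygonal region with vertices $P_0(w),\dots,P_m(w)$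 (or merely in their convex hull), and that $\tau$ is admissible for every configuration over every $w\in\mathcal W\cap\Omega$ and every implicit regular point $v_0$. Let $\widetilde L_{t^*}(w)$ be $L_{t^*}$ with the length of each edge from a node $x$ to $v_0$ replaced by $\max_j|p_x(w)-P_j(w)|$. Then the function equal to $\rho\widetilde L_{t^*}+L_{S^+}-L_{S^-}$ on $\Omega$ and to $+\infty$ off $\Omega$ is a verification function, with underlying splitting $\tau$. 2. (Valid 4-Point Steiner Tree Lemma.) Let $\Omega$ be an orthogonally convex set (every axis-parallel line meets it in an interval), and let $X_1,\dots,X_4$ be nodes. Suppose that, for every $w\in\mathcal W\cap\Omega$ over which there is a configuration, the $(X_1X_2)$-$(X_3X_4)$ type Steiner tree is valid. Here the $(AB)$-$(CD)$ type tree is valid if $A,B,C,D$ are the vertices, in clockwise order, of a convex quadrilateral; the angles $UCD,UDC,VAB,VBA$ are at most $120^\circ$, where $U$ is $B$ rotated by $60^\circ$ counterclockwise about $A$ and $V$ is $D$ rotated by $60^\circ$ counterclockwise about $C$; and the angle $AOB$ at the intersection $O$ of the diagonals is at most $120^\circ$. Suppose that $t^*$ uses no implicit regular point; that $S^+$ includes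 the $(X_1X_2)$-$(X_3X_4)$ tree, whose two Steiner points are auxiliary vertices with no other edges; and that $\tau$ is admissible for every configuration over every $w\in\mathcal W\cap\Omega$. Let $\widetilde L_{S^+}(w)$ be $|UV|$, formed from $p_{X_1}(w),\dots,p_{X_4}(w)$, plus the length of the rest of $S^+$ (its auxiliary vertices again placed optimally). Then the function equal to $\rho L_{t^*}+\widetilde L_{S^+}-L_{S^-}$ on $\Omega$ and to $+\infty$ off $\Omega$ is a verification function, with underlying splitting $\tau$. -/

import Mathlib

noncomputable section

namespace SteinerVer

open EuclideanGeometry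

/-! ### Geometric graphs and Steiner trees in the plane `ℂ` -/

/-- Euclidean length of an edge. -/
def edgeLen : Sym2 ℂ → ℝ :=
  Sym2.lift ⟨fun x y => dist x y, fun x y => dist_comm x y⟩

/-- Total edge length `L_E` of a finite geometric graph with edge set `E`. -/
def totalLen (E : Finset (Sym2 ℂ)) : ℝ := ∑ e ∈ E, edgeLen e

/-- The edge set `E` forms a tree that contains all the `terminals`
(the other vertices are Steiner points). -/
def IsSteinerTree {α : Type*} (terminals : Set α) (E : Set (Sym2 α)) : Prop :=
  ∃ P : Set α, terminals ⊆ P ∧ (∀ e ∈ E, ¬ e.IsDiag ∧ ∀ x ∈ e, x ∈ P) ∧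
    ((SimpleGraph.fromEdgeSet E).induce P).IsTree

/-- `E` is a Steiner minimal tree of the finite point set `V`. -/
def IsSteinerMinimalTree (V : Finset ℂ) (E : Finset (Sym2 ℂ)) : Prop :=
  IsSteinerTree (V : Set ℂ) (E : Set (Sym2 ℂ)) ∧
    ∀ E' : Finset (Sym2 ℂ), IsSteinerTree (V : Set ℂ) (E' : Set (Sym2 ℂ)) →
      totalLen E ≤ totalLen E'

/-- Number of edges of `E` at the point `x`. -/
def degree (E : Finset (Sym2 ℂ)) (x : ℂ) : ℕ := {e : Sym2 ℂ | e ∈ E ∧ x ∈ e}.ncard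

/-- Admissible splits `(V*, S⁻, S⁺, t*)` of a tree with edge set `S` on the regular points `V`.
The graph `S⁺` may use `k` new auxiliary vertices. -/
structure IsSplit (V : Set ℂ) (S : Set (Sym2 ℂ)) (Vstar : Set ℂ) (Sminus : Set (Sym2 ℂ))
    {k : ℕ} (Splus : Set (Sym2 (ℂ ⊕ Fin k))) (tstar : Set (Sym2 ℂ)) : Prop where
  nonempty : Vstar.Nonempty
  ssubset : Vstar ⊂ V
  removed : Sminus ⊆ S
  detached : ∀ e ∈ S \ Sminus, ∀ x ∈ Vstar, x ∉ e
  t_edges : ∀ e ∈ tstar, ¬ e.IsDiag ∧ ∀ x ∈ e, x ∈ V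
  t_forest : (SimpleGraph.fromEdgeSet tstar).IsAcyclic
  t_connects : ∀ x ∈ Vstar, ∃ y ∈ V \ Vstar, (SimpleGraph.fromEdgeSet tstar).Reachable x y
  t_separates : ∀ y₁ ∈ V \ Vstar, ∀ y₂ ∈ V \ Vstar, y₁ ≠ y₂ →
    ¬ (SimpleGraph.fromEdgeSet tstar).Reachable y₁ y₂
  reconnected : IsSteinerTree (Sum.inl '' (V \ Vstar))
    (Sym2.map Sum.inl '' (S \ Sminus) ∪ Splus)

/-! ### Local tree topologies and their edge-length parameters -/

/-- The nodes of a local topology: a regular point, a Steiner point, or a boundary node, where the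
rest of the tree is attached and which may be of either kind. -/
inductive NodeKind
  | regular
  | steiner
  | boundary

/-- A local tree topology. The nodes are `0, …, n`; edge `j` joins node `j + 1` to `parent j`.
Seen from the parent, edge `j` has direction `dir j`, in multiples of `60°`; its length is the
parameter `label j`, or the normalized length `1` if `label j = none`. -/
structure LocalTopology (ι : Type*) where
  n : ℕ
  parent : Fin n → Fin (n + 1)
  parent_le : ∀ j, parent j ≤ j.castSucc
  dir : Fin n → ZMod 6
  label : Fin n → Option ι
  kind : Fin (n + 1) → NodeKind
  /-- Regular and boundary nodes are leaves. -/
  leaf : ∀ x, kind x ≠ NodeKind.steiner →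
    (Finset.univ.filter fun j => parent j = x ∨ j.succ = x).card = 1
  /-- Steiner nodes have degree three. -/
  steiner_degree : ∀ x, kind x = NodeKind.steiner →
    (Finset.univ.filter fun j => parent j = x ∨ j.succ = x).card = 3
  /-- The edges at a Steiner node pairwise make an angle of `120°`. -/
  steiner_angle : ∀ x, kind x = NodeKind.steiner → ∀ i j, i ≠ j →
    (parent i = x ∨ i.succ = x) → (parent j = x ∨ j.succ = x) →
    (if parent i = x then dir i else dir i + 3) - (if parent j = x then dir j else dir j + 3) = 2 ∨
    (if parent i = x then dir i else dir i + 3) - (if parent j = x then dir j else dir j + 3) = 4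

/-- The unit vector with argument `k · 60°`. -/
def unitDir (k : ZMod 6) : ℂ := Complex.exp (((k.val : ℝ) * (Real.pi / 3) : ℝ) * Complex.I)

/-- The parameter space `𝒲` of edge-length vectors. -/
def paramSpace (ι : Type*) : Set (ι → ℝ) := {w | ∀ i, 0 ≤ w i}

namespace LocalTopology

variable {ι : Type*} (T : LocalTopology ι)

/-- The nodes of the topology. -/
abbrev Node : Type := Fin (T.n + 1)

/-- The length of edge `j` in the geometric configuration `w`. -/
def len (w : ι → ℝ) (j : Fin T.n) : ℝ := (T.label j).elim 1 w

/-- The position of a node in the geometric configuration `w`; node `0` is at the origin. -/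
def pos (w : ι → ℝ) : Fin (T.n + 1) → ℂ
  | ⟨0, _⟩ => 0
  | ⟨j + 1, h⟩ =>
      pos w (T.parent ⟨j, Nat.lt_of_succ_lt_succ h⟩) +
        (T.len w ⟨j, Nat.lt_of_succ_lt_succ h⟩ : ℂ) * unitDir (T.dir ⟨j, Nat.lt_of_succ_lt_succ h⟩)
termination_by x => x.val
decreasing_by
  have := T.parent_le ⟨j, Nat.lt_of_succ_lt_succ h⟩
  exact Nat.lt_succ_of_le (by simpa [Fin.le_def] using this)

/-- The edge `j`, as a segment of the plane. -/
def edge (w : ι → ℝ) (j : Fin T.n) : Sym2 ℂ := s(T.pos w (T.parent j), T.pos w j.succ)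

end LocalTopology

/-- The terminal substructure with nodes `X, A, B, Y, D, Z, R, Q` (in this order), in which `D` is a
regular point; `|AX| = 1`, and the parameters are the lengths of `XB, XY, YD, YZ, ZR, ZQ`. -/
def topologyRegular : LocalTopology (Fin 6) where
  n := 7
  parent := ![0, 0, 0, 3, 3, 5, 5]
  parent_le := by decide
  dir := ![3, 1, 5, 0, 4, 3, 5]
  label := ![none, some 0, some 1, some 2, some 3, some 4, some 5]
  kind := ![.steiner, .regular, .regular, .steiner, .regular, .steiner, .boundary, .boundary]
  leaf := by intro x; fin_cases x <;> simp <;> decide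
  steiner_degree := by intro x; fin_cases x <;> simp <;> decide
  steiner_angle := by intro x; fin_cases x <;> simp <;> decide

/-- The terminal substructure with nodes `X, A, B, Y, D, Z, R, Q, U, V` (in this order), in which
`D` is a Steiner point joined to the regular points `U, V`; `|AX| = 1`, and the parameters are the
lengths of `XB, XY, YD, YZ, ZR, ZQ, DU, DV`. -/
def topologySteiner : LocalTopology (Fin 8) where
  n := 9
  parent := ![0, 0, 0, 3, 3, 5, 5, 4, 4]
  parent_le := by decide
  dir := ![3, 1, 5, 0, 4, 3, 5, 5, 1]
  label := ![none, some 0, some 1, some 2, some 3, some 4, some 5, some 6, some 7]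
  kind := ![.steiner, .regular, .regular, .steiner, .steiner, .steiner, .boundary, .boundary,
    .regular, .regular]
  leaf := by intro x; fin_cases x <;> simp <;> decide
  steiner_degree := by intro x; fin_cases x <;> simp <;> decide
  steiner_angle := by intro x; fin_cases x <;> simp <;> decide

/-- A full Steiner minimal tree `S`, on a finite set `V` of regular points, that contains the local
topology `T` with edge lengths `w` (in coordinates adapted to `T`). -/
structure Config {ι : Type*} (T : LocalTopology ι) (w : ι → ℝ) where
  V : Finset ℂ
  S : Finset (Sym2 ℂ)
  minimal : IsSteinerMinimalTree V S
  regular_degree : ∀ v ∈ V, degree S v = 1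
  steiner_degree : ∀ e ∈ S, ∀ x ∈ e, x ∉ V → degree S x = 3
  pos_injective : Function.Injective (T.pos w)
  edge_mem : ∀ j, T.edge w j ∈ S
  regular_mem : ∀ x, T.kind x = NodeKind.regular → T.pos w x ∈ V
  steiner_notMem : ∀ x, T.kind x = NodeKind.steiner → T.pos w x ∉ V

/-- An implicit regular point: one that is not an explicit regular point of the local topology. -/
def Config.IsImplicit {ι : Type*} {T : LocalTopology ι} {w : ι → ℝ} (C : Config T w) (v : ℂ) :
    Prop :=
  v ∈ C.V ∧ ∀ x, T.kind x = NodeKind.regular → v ≠ T.pos w x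

/-! ### Splittings and splitting functions -/

/-- A choice of splitting `τ = (V*, S⁻, S⁺, t*)` in terms of a local topology.
`Splus` is a graph on nodes and `aux` auxiliary vertices. The graph `t*` consists of the edges
`tExplicit` between nodes, and of edges from the nodes in `tImplicit` to one implicit regular
point. -/
structure Splitting {ι : Type*} (T : LocalTopology ι) where
  Vstar : Finset T.Node
  Sminus : Finset (Fin T.n)
  aux : ℕ
  Splus : Finset (Sym2 (T.Node ⊕ Fin aux))
  tExplicit : Finset (Sym2 T.Node)
  tImplicit : Finset T.Node

namespace Splitting

variable {ι : Type*} {T : LocalTopology ι} (τ : Splitting T)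

/-- The splitting `τ`, with implicit regular point `v`, is an admissible split of the tree `C`. -/
def Admissible {w : ι → ℝ} (C : Config T w) (v : ℂ) : Prop :=
  IsSplit (C.V : Set ℂ) (C.S : Set (Sym2 ℂ)) (T.pos w '' τ.Vstar) (T.edge w '' τ.Sminus)
    (Sym2.map (Sum.map (T.pos w) id) '' (τ.Splus : Set (Sym2 (T.Node ⊕ Fin τ.aux))))
    (Sym2.map (T.pos w) '' τ.tExplicit ∪ (fun x => s(T.pos w x, v)) '' τ.tImplicit)

/-- `L_{S⁻}`. -/
def lenSminus (w : ι → ℝ) : ℝ := ∑ j ∈ τ.Sminus, edgeLen (T.edge w j)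

/-- Total length of a graph on nodes and auxiliary vertices, the auxiliary vertices being placed
so as to minimize it. -/
def steinerLen (T : LocalTopology ι) {k : ℕ} (E : Finset (Sym2 (T.Node ⊕ Fin k))) (w : ι → ℝ) : ℝ :=
  ⨅ q : Fin k → ℂ, ∑ e ∈ E, edgeLen (e.map (Sum.elim (T.pos w) q))

/-- `L_{S⁺}`. -/
def lenSplus (w : ι → ℝ) : ℝ := steinerLen T τ.Splus w

/-- Total length of the explicit edges of `t*`. -/
def lenExplicit (w : ι → ℝ) : ℝ := ∑ e ∈ τ.tExplicit, edgeLen (e.map (T.pos w))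

/-- `L_{t*}`, with implicit regular point `v`. -/
def lenTstar (w : ι → ℝ) (v : ℂ) : ℝ := τ.lenExplicit w + ∑ x ∈ τ.tImplicit, dist (T.pos w x) v

open scoped Classical in
/-- The splitting function `F_τ = ρ L_{t*} + L_{S⁺} - L_{S⁻}`, where `σ` names the implicit regular
point of each tree; the value is `+∞` where `τ` is not admissible. -/
def splittingFunction (ρ : ℝ) (σ : ∀ w, Config T w → ℂ) (w : ι → ℝ) (C : Config T w) : WithTop ℝ :=
  if τ.Admissible C (σ w C) then
    ((ρ * τ.lenTstar w (σ w C) + τ.lenSplus w - τ.lenSminus w : ℝ) : WithTop ℝ)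
  else ⊤

end Splitting

/-! ### Verification functions -/

/-- `h` is first non-increasing and then non-decreasing on `I` (either phase may be empty). -/
def UnimodalOn (h : ℝ → WithTop ℝ) (I : Set ℝ) : Prop :=
  ∃ L : Set ℝ, IsLowerSet L ∧ AntitoneOn h (I ∩ L) ∧ MonotoneOn h (I \ L)

/-- Shape constraint: `f` is unimodal on the part in `𝒲` of every axis-parallel line. -/
def ShapeConstraint {ι : Type*} [DecidableEq ι] (f : (ι → ℝ) → WithTop ℝ) : Prop :=
  ∀ w ∈ paramSpace ι, ∀ i, UnimodalOn (fun x => f (Function.update w i x)) (Set.Ici 0)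

/-- `f` bounds from above, on `𝒲`, a splitting function that belongs to the splitting `τ`. -/
def BoundsSplitting {ι : Type*} {T : LocalTopology ι} (ρ : ℝ) (τ : Splitting T)
    (f : (ι → ℝ) → WithTop ℝ) : Prop :=
  ∃ σ : ∀ w, Config T w → ℂ, ∀ w ∈ paramSpace ι, ∀ C : Config T w,
    τ.splittingFunction ρ σ w C ≤ f w

/-- Verification functions: the shape constraint and the bounding constraint. -/
def IsVerificationFunction {ι : Type*} [DecidableEq ι] (T : LocalTopology ι) (ρ : ℝ)
    (f : (ι → ℝ) → WithTop ℝ) : Prop :=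
  ShapeConstraint f ∧ ∃ τ : Splitting T, BoundsSplitting ρ τ f

/-! ### Trapped regular points -/

/-- A finite system of linear (affine) inequalities, weak and strict. -/
structure LinearConstraints (ι : Type*) where
  weak : List ((ι → ℝ) →ᵃ[ℝ] ℝ)
  strict : List ((ι → ℝ) →ᵃ[ℝ] ℝ)

/-- The set of solutions. -/
def LinearConstraints.region {ι : Type*} (c : LinearConstraints ι) : Set (ι → ℝ) :=
  {w | (∀ a ∈ c.weak, a w ≤ 0) ∧ ∀ a ∈ c.strict, a w < 0}

/-- For `w ∈ Ω` an implicit regular point lies within the bounded polygonal region with vertices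
`P j w`. Any such region is contained in the convex hull of its vertices, and only this is asked. -/
def TrappedRegularPointLemma {ι : Type*} (T : LocalTopology ι) (Ω : Set (ι → ℝ)) {m : ℕ}
    (P : Fin (m + 1) → (ι → ℝ) →ᵃ[ℝ] ℂ) : Prop :=
  ∀ w ∈ paramSpace ι, w ∈ Ω → ∀ C : Config T w,
    ∃ v, C.IsImplicit v ∧ v ∈ convexHull ℝ (Set.range fun j => P j w)

/-- The upper bound for `L_{t*}`: the distance from a node to the implicit regular point is replaced
by the largest distance from the node to a vertex of the polygonal region. -/
def Splitting.boundTstar {ι : Type*} {T : LocalTopology ι} (τ : Splitting T) {m : ℕ}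
    (P : Fin (m + 1) → (ι → ℝ) →ᵃ[ℝ] ℂ) (w : ι → ℝ) : ℝ :=
  τ.lenExplicit w + ∑ x ∈ τ.tImplicit, ⨆ j, dist (T.pos w x) (P j w)

/-! ### Four-point Steiner trees -/

/-- `B` rotated counterclockwise by `60°` about `A`. -/
def apex (A B : ℂ) : ℂ := A + (B - A) * Complex.exp ((Real.pi / 3 : ℝ) * Complex.I)

/-- The cross product of two vectors of the plane. -/
def cross (u v : ℂ) : ℝ := u.re * v.im - u.im * v.re

/-- The `(AB)-(CD)` type Steiner tree is valid, with `U = apex A B` and `V = apex C D`. -/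
structure ValidFourPoint (A B C D : ℂ) : Prop where
  /-- `A, B, C, D` are the vertices of a convex quadrilateral, in clockwise order. -/
  convex : cross (B - A) (C - B) < 0 ∧ cross (C - B) (D - C) < 0 ∧
    cross (D - C) (A - D) < 0 ∧ cross (A - D) (B - A) < 0
  angle_UCD : ∠ (apex A B) C D ≤ 2 * Real.pi / 3
  angle_UDC : ∠ (apex A B) D C ≤ 2 * Real.pi / 3
  angle_VAB : ∠ (apex C D) A B ≤ 2 * Real.pi / 3
  angle_VBA : ∠ (apex C D) B A ≤ 2 * Real.pi / 3
  /-- The angle `AOB` at the intersection `O` of the diagonals is at most `120°`. -/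
  angle_diagonals : ∃ O ∈ segment ℝ A C ∩ segment ℝ B D, ∠ A O B ≤ 2 * Real.pi / 3

/-- Orthogonally convex sets: every axis-parallel line meets the set in an interval. -/
def OrthConvex {ι : Type*} [DecidableEq ι] (Ω : Set (ι → ℝ)) : Prop :=
  ∀ w i, {x : ℝ | Function.update w i x ∈ Ω}.OrdConnected

/-- For `w ∈ Ω` the `(X₁X₂)-(X₃X₄)` type Steiner tree on four nodes is valid. -/
def ValidFourPointLemma {ι : Type*} (T : LocalTopology ι) (Ω : Set (ι → ℝ))
    (X : Fin 4 → T.Node) : Prop :=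
  ∀ w ∈ paramSpace ι, w ∈ Ω → Nonempty (Config T w) →
    ValidFourPoint (T.pos w (X 0)) (T.pos w (X 1)) (T.pos w (X 2)) (T.pos w (X 3))

namespace Splitting

variable {ι : Type*} {T : LocalTopology ι} (τ : Splitting T)

/-- The five edges of the `(X₁X₂)-(X₃X₄)` type tree whose Steiner points are the auxiliary vertices
`a` (joined to `X₁, X₂`) and `b` (joined to `X₃, X₄`). -/
def fourPointTree {k : ℕ} (X : Fin 4 → T.Node) (a b : Fin k) : Finset (Sym2 (T.Node ⊕ Fin k)) :=
  {s(.inl (X 0), .inr a), s(.inl (X 1), .inr a), s(.inr a, .inr b),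
    s(.inr b, .inl (X 2)), s(.inr b, .inl (X 3))}

/-- `S⁺` includes the four-point tree, and `a, b` have no further edges. -/
structure IncludesFourPointTree (X : Fin 4 → T.Node) (a b : Fin τ.aux) : Prop where
  ne : a ≠ b
  subset : fourPointTree X a b ⊆ τ.Splus
  only : ∀ e ∈ τ.Splus, (Sum.inr a ∈ e ∨ Sum.inr b ∈ e) → e ∈ fourPointTree X a b

/-- The upper bound for `L_{S⁺}`: the length of the four-point tree is replaced by `|UV|`. -/
def boundSplus (X : Fin 4 → T.Node) (a b : Fin τ.aux) (w : ι → ℝ) : ℝ :=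
  dist (apex (T.pos w (X 0)) (T.pos w (X 1))) (apex (T.pos w (X 2)) (T.pos w (X 3))) +
    steinerLen T (τ.Splus \ fourPointTree X a b) w

end Splitting

open scoped Classical in
/-- The function with real values `g w` on `Ω`, and `+∞` elsewhere. -/
def onRegion {ι : Type*} (Ω : Set (ι → ℝ)) (g : (ι → ℝ) → ℝ) (w : ι → ℝ) : WithTop ℝ :=
  if w ∈ Ω then (g w : WithTop ℝ) else ⊤

end SteinerVer

end

open SteinerVer

namespace SteinerVer

/-! ### Quasiconvex functions are unimodal -/

/-! Shape. Edge directions are fixed, so node positions are affine in `w`. Every distance between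
affinely moving points is then convex, and so are sums, finite maxima and partial minima of such
distances. The subtracted length of S⁻ is even affine on `paramSpace`, since there each edge length
is a parameter or 1. Hence both bounds are convex functions of `w`. Replacing the values off Ω by +∞
keeps them quasiconvex along axis-parallel lines, because Ω meets each such line in an interval, and
a quasiconvex function on an interval is unimodal (`shapeConstraint_onRegion`).

Bounding, trapped point. The distance to a fixed node attains its maximum over a convex hull at one
of the spanning points, which gives `lenTstar_le_boundTstar`.

Bounding, four points. It suffices to exhibit Steiner points for which the tree has length |UV|
(`ValidFourPoint.exists_steiner_points`). The angle conditions at A, B, C, D put each apex on the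
correct side of the opposite edge (`cross_apex_nonneg`) and then give a Steiner point on the line UV
for each pair (`exists_simpson_point`), with |US₁| = |AS₁| + |BS₁| and similarly at V. Convexity and
the condition on the diagonals ensure that S₁ and S₂ come in the right order on UV
(`nonneg_of_diagonal_angle`), so the five lengths add up to |UV|. -/

theorem unimodalOn_of_quasiconvex {h : ℝ → WithTop ℝ} {I : Set ℝ}
    (hq : ∀ x ∈ I, ∀ y ∈ I, ∀ z ∈ I, x < y → y < z → h y ≤ max (h x) (h z)) :
    UnimodalOn h I := by
  -- The decreasing phase consists of all points from which, there or further right, a strict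
  -- descent still begins. This needs neither a minimizer nor continuity. A rise inside this phase,
  -- followed by the later descent, would contradict quasiconvexity.
  refine ⟨{x | ∃ x' ∈ I, ∃ y ∈ I, x ≤ x' ∧ x' < y ∧ h y < h x'}, ?_, ?_, ?_⟩
  · rintro x y hyx ⟨x', hx', z, hz, hxx', hlt, hh⟩
    exact ⟨x', hx', z, hz, hyx.trans hxx', hlt, hh⟩
  · rintro u ⟨hu, -⟩ v ⟨hv, x', hx', y, hy, hvx', hlt, hh⟩ huv
    by_contra! hcon
    have huv' : u < v := lt_of_le_of_ne huv (by rintro rfl; exact lt_irrefl _ hcon)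
    have hvy : h v ≤ h y :=
      (le_max_iff.1 (hq u hu v hv y hy huv' (hvx'.trans_lt hlt))).resolve_left (not_le.2 hcon)
    have hvx : v < x' := lt_of_le_of_ne hvx' (by rintro rfl; exact absurd hvy (not_le.2 hh))
    have := hq v hv x' hx' y hy hvx hlt
    rw [max_eq_right hvy] at this
    exact absurd this (not_le.2 hh)
  · rintro u ⟨hu, huL⟩ v ⟨hv, -⟩ huv
    by_contra! hcon
    have huv' : u < v := lt_of_le_of_ne huv (by rintro rfl; exact lt_irrefl _ hcon)
    exact huL ⟨u, hu, v, hv, le_rfl, huv', hcon⟩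

theorem convex_paramSpace (ι : Type*) : Convex ℝ (paramSpace ι) := by
  intro v hv w hw a b ha hb _ i
  have h₁ := mul_nonneg ha (hv i)
  have h₂ := mul_nonneg hb (hw i)
  simpa using add_nonneg h₁ h₂

theorem update_combo {ι : Type*} [DecidableEq ι] {w : ι → ℝ} {i : ι} {x y a b : ℝ}
    (hab : a + b = 1) : Function.update w i (a • x + b • y) =
      a • Function.update w i x + b • Function.update w i y := by
  funext j
  rcases eq_or_ne j i with rfl | hj
  · simp
  · simp only [Function.update_of_ne hj, Pi.add_apply, Pi.smul_apply, smul_eq_mul]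
    rw [← add_mul, hab, one_mul]

/-- If an outer point lies off Ω, the maximum of the outer values is +∞ and nothing is required.
Otherwise the middle point is in Ω too, and convexity of `g` applies. -/
theorem shapeConstraint_onRegion {ι : Type*} [DecidableEq ι] {Ω : Set (ι → ℝ)}
    {g : (ι → ℝ) → ℝ} (hΩ : OrthConvex Ω) (hg : ConvexOn ℝ (paramSpace ι) g) :
    ShapeConstraint (onRegion Ω g) := by
  intro w hw i
  have hmem : ∀ x ∈ Set.Ici (0 : ℝ), Function.update w i x ∈ paramSpace ι := by
    intro x hx j
    rcases eq_or_ne j i with rfl | hj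
    · simpa using hx
    · simpa [hj] using hw j
  have hconv : ConvexOn ℝ (Set.Ici (0 : ℝ)) fun x => g (Function.update w i x) := by
    refine ⟨convex_Ici _, fun x hx y hy a b ha hb hab => ?_⟩
    simpa only [update_combo hab] using hg.2 (hmem x hx) (hmem y hy) ha hb hab
  refine unimodalOn_of_quasiconvex fun x hx y _ z hz hxy hyz => ?_
  by_cases hxΩ : Function.update w i x ∈ Ω
  · by_cases hzΩ : Function.update w i z ∈ Ω
    · have hyΩ : Function.update w i y ∈ Ω := (hΩ w i).out hxΩ hzΩ ⟨hxy.le, hyz.le⟩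
      have := hconv.le_max_of_mem_Icc hx hz ⟨hxy.le, hyz.le⟩
      simp only [onRegion, hxΩ, hyΩ, hzΩ, if_true]
      exact_mod_cast this
    · simp [onRegion, hzΩ]
  · simp [onRegion, hxΩ]

theorem LinearConstraints.orthConvex_region {ι : Type*} [DecidableEq ι]
    (c : LinearConstraints ι) : OrthConvex c.region := by
  have hconv : Convex ℝ c.region := by
    intro v hv w hw a b ha hb hab
    refine ⟨fun f hf => ?_, fun f hf => ?_⟩
    · rw [Convex.combo_affine_apply hab]
      exact (convex_Iic (0 : ℝ)) (hv.1 f hf) (hw.1 f hf) ha hb hab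
    · rw [Convex.combo_affine_apply hab]
      exact (convex_Iio (0 : ℝ)) (hv.2 f hf) (hw.2 f hf) ha hb hab
  intro w i
  refine Convex.ordConnected fun x hx y hy a b ha hb hab => ?_
  simpa only [Set.mem_ofPred_eq, update_combo hab] using hconv hx hy ha hb hab

/-! ### Convexity of the length functions -/

theorem edgeLen_mk (x y : ℂ) : edgeLen s(x, y) = dist x y := rfl

theorem edgeLen_nonneg (e : Sym2 ℂ) : 0 ≤ edgeLen e := by
  induction e with
  | _ x y => exact dist_nonneg (x := x) (y := y)

theorem edgeLen_map_combo_le {α : Type*} (e : Sym2 α) (p q : α → ℂ) {a b : ℝ} (ha : 0 ≤ a)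
    (hb : 0 ≤ b) :
    edgeLen (e.map fun x => a • p x + b • q x) ≤
      a * edgeLen (e.map p) + b * edgeLen (e.map q) := by
  induction e with
  | _ x y =>
    simp only [Sym2.map_mk, edgeLen_mk]
    calc dist (a • p x + b • q x) (a • p y + b • q y)
        ≤ dist (a • p x) (a • p y) + dist (b • q x) (b • q y) := dist_add_add_le _ _ _ _
      _ = a * dist (p x) (p y) + b * dist (q x) (q y) := by
          rw [dist_smul₀, dist_smul₀, Real.norm_of_nonneg ha, Real.norm_of_nonneg hb]

/-! ### Affine dependence of the node positions on the parameters -/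

namespace LocalTopology

variable {ι : Type*} (T : LocalTopology ι)

theorem len_combo (v w : ι → ℝ) {a b : ℝ} (hab : a + b = 1) (j : Fin T.n) :
    T.len (a • v + b • w) j = a * T.len v j + b * T.len w j := by
  unfold len
  cases T.label j <;> simp [hab]

theorem len_nonneg {w : ι → ℝ} (hw : w ∈ paramSpace ι) (j : Fin T.n) : 0 ≤ T.len w j := by
  unfold len
  cases h : T.label j with
  | none => simp
  | some i => simpa using hw i

theorem pos_zero (w : ι → ℝ) : T.pos w 0 = 0 := by
  rw [pos.eq_def]
  rfl

theorem pos_succ (w : ι → ℝ) (j : Fin T.n) :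
    T.pos w j.succ = T.pos w (T.parent j) + (T.len w j : ℂ) * unitDir (T.dir j) := by
  rw [pos.eq_def]
  rfl

/-- A position is a sum of fixed unit vectors weighted by edge lengths along the path to the root.
The condition a + b = 1 is needed because of the normalized edges of constant length 1. -/
theorem pos_combo (v w : ι → ℝ) {a b : ℝ} (hab : a + b = 1) (x : T.Node) :
    T.pos (a • v + b • w) x = a • T.pos v x + b • T.pos w x := by
  induction hn : x.val using Nat.strong_induction_on generalizing x with
  | _ n ih =>
    cases x using Fin.cases with
    | zero => simp [pos_zero]
    | succ j =>
      have hlt : (T.parent j).val < n := by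
        have := T.parent_le j
        rw [Fin.le_def] at this
        simp at this hn
        omega
      rw [pos_succ, pos_succ, pos_succ, ih _ hlt _ rfl, len_combo T v w hab]
      simp only [Complex.real_smul]
      push_cast
      ring

theorem norm_unitDir (k : ZMod 6) : ‖unitDir k‖ = 1 := Complex.norm_exp_ofReal_mul_I _

theorem edgeLen_edge {w : ι → ℝ} (hw : w ∈ paramSpace ι) (j : Fin T.n) :
    edgeLen (T.edge w j) = T.len w j := by
  rw [edge, edgeLen_mk, pos_succ, dist_self_add_right, norm_mul, norm_unitDir, mul_one,
    Complex.norm_real, Real.norm_of_nonneg (T.len_nonneg hw j)]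

end LocalTopology

namespace Splitting

variable {ι : Type*} {T : LocalTopology ι} (τ : Splitting T)

/-- S⁻ enters with a minus sign, so convexity of lengths would not suffice. For nonnegative
parameters each edge length is exactly `len`, which is affine. -/
theorem concaveOn_lenSminus : ConcaveOn ℝ (paramSpace ι) τ.lenSminus := by
  refine ⟨convex_paramSpace ι, fun v hv w hw a b ha hb hab => le_of_eq ?_⟩
  simp only [lenSminus, T.edgeLen_edge hv, T.edgeLen_edge hw,
    T.edgeLen_edge (convex_paramSpace ι hv hw ha hb hab), T.len_combo v w hab, smul_eq_mul,
    Finset.sum_add_distrib, Finset.mul_sum]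

theorem convexOn_lenExplicit : ConvexOn ℝ (paramSpace ι) τ.lenExplicit := by
  refine ⟨convex_paramSpace ι, fun v _ w _ a b ha hb hab => ?_⟩
  simp only [lenExplicit, smul_eq_mul, Finset.mul_sum]
  rw [← Finset.sum_add_distrib]
  refine Finset.sum_le_sum fun e _ => ?_
  rw [show T.pos (a • v + b • w) = fun x => a • T.pos v x + b • T.pos w x from
    funext fun x => T.pos_combo v w hab x]
  exact edgeLen_map_combo_le e _ _ ha hb

theorem bddBelow_sum_edgeLen {k : ℕ} (E : Finset (Sym2 (T.Node ⊕ Fin k))) (w : ι → ℝ) :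
    BddBelow (Set.range fun q : Fin k → ℂ =>
      ∑ e ∈ E, edgeLen (e.map (Sum.elim (T.pos w) q))) :=
  ⟨0, by rintro _ ⟨q, rfl⟩; exact Finset.sum_nonneg fun e _ => edgeLen_nonneg _⟩

theorem steinerLen_le {k : ℕ} (E : Finset (Sym2 (T.Node ⊕ Fin k))) (w : ι → ℝ)
    (q : Fin k → ℂ) :
    steinerLen T E w ≤ ∑ e ∈ E, edgeLen (e.map (Sum.elim (T.pos w) q)) :=
  ciInf_le (bddBelow_sum_edgeLen E w) q

/-- Partial minimization of a jointly convex function is convex. Near-optimal placements at the two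
ends are combined, so attainment of the infimum is not needed. -/
theorem convexOn_steinerLen {k : ℕ} (E : Finset (Sym2 (T.Node ⊕ Fin k))) :
    ConvexOn ℝ (paramSpace ι) (steinerLen T E) := by
  refine ⟨convex_paramSpace ι, fun v _ w _ a b ha hb hab => ?_⟩
  refine le_of_forall_pos_le_add fun ε hε => ?_
  obtain ⟨q, hq⟩ := exists_lt_of_ciInf_lt (lt_add_of_pos_right (steinerLen T E v) hε)
  obtain ⟨q', hq'⟩ := exists_lt_of_ciInf_lt (lt_add_of_pos_right (steinerLen T E w) hε)
  have hle := steinerLen_le E (a • v + b • w) fun i => a • q i + b • q' i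
  have hmap : Sum.elim (T.pos (a • v + b • w)) (fun i => a • q i + b • q' i) =
      fun x => a • Sum.elim (T.pos v) q x + b • Sum.elim (T.pos w) q' x := by
    funext x
    rcases x with x | i
    · exact T.pos_combo v w hab x
    · rfl
  have hsum : ∑ e ∈ E, edgeLen (e.map (Sum.elim (T.pos (a • v + b • w))
        fun i => a • q i + b • q' i)) ≤
      a * ∑ e ∈ E, edgeLen (e.map (Sum.elim (T.pos v) q)) +
        b * ∑ e ∈ E, edgeLen (e.map (Sum.elim (T.pos w) q')) := by
    rw [Finset.mul_sum, Finset.mul_sum, ← Finset.sum_add_distrib]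
    refine Finset.sum_le_sum fun e _ => ?_
    rw [hmap]
    exact edgeLen_map_combo_le e _ _ ha hb
  have h₁ := mul_le_mul_of_nonneg_left hq.le ha
  have h₂ := mul_le_mul_of_nonneg_left hq'.le hb
  have h₃ : a * ε + b * ε = ε := by rw [← add_mul, hab, one_mul]
  simp only [smul_eq_mul]
  linarith

theorem dist_le_iSup {m : ℕ} (P : Fin (m + 1) → ℂ) (z : ℂ) (j : Fin (m + 1)) :
    dist z (P j) ≤ ⨆ j, dist z (P j) :=
  le_ciSup (f := fun j => dist z (P j)) (Set.finite_range _).bddAbove j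

theorem convexOn_iSup_dist {m : ℕ} (P : Fin (m + 1) → (ι → ℝ) →ᵃ[ℝ] ℂ) (x : T.Node) :
    ConvexOn ℝ (paramSpace ι) fun w => ⨆ j, dist (T.pos w x) (P j w) := by
  refine ⟨convex_paramSpace ι, fun v _ w _ a b ha hb hab => ciSup_le fun j => ?_⟩
  rw [T.pos_combo v w hab, Convex.combo_affine_apply hab]
  calc dist (a • T.pos v x + b • T.pos w x) (a • P j v + b • P j w)
      ≤ dist (a • T.pos v x) (a • P j v) + dist (b • T.pos w x) (b • P j w) :=
        dist_add_add_le _ _ _ _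
    _ = a * dist (T.pos v x) (P j v) + b * dist (T.pos w x) (P j w) := by
        rw [dist_smul₀, dist_smul₀, Real.norm_of_nonneg ha, Real.norm_of_nonneg hb]
    _ ≤ _ := add_le_add
        (mul_le_mul_of_nonneg_left (dist_le_iSup (fun j => P j v) (T.pos v x) j) ha)
        (mul_le_mul_of_nonneg_left (dist_le_iSup (fun j => P j w) (T.pos w x) j) hb)

theorem convexOn_boundTstar {m : ℕ} (P : Fin (m + 1) → (ι → ℝ) →ᵃ[ℝ] ℂ) :
    ConvexOn ℝ (paramSpace ι) (τ.boundTstar P) := by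
  have hsum : ConvexOn ℝ (paramSpace ι) fun w =>
      ∑ x ∈ τ.tImplicit, ⨆ j, dist (T.pos w x) (P j w) := by
    refine ⟨convex_paramSpace ι, fun v hv w hw a b ha hb hab => ?_⟩
    simp only [smul_eq_mul, Finset.mul_sum]
    rw [← Finset.sum_add_distrib]
    exact Finset.sum_le_sum fun x _ => (convexOn_iSup_dist P x).2 hv hw ha hb hab
  exact τ.convexOn_lenExplicit.add hsum

/-- A convex function on a convex hull is bounded by its largest value on the generating points,
applied here to the distance from each node. -/
theorem lenTstar_le_boundTstar {m : ℕ} (P : Fin (m + 1) → (ι → ℝ) →ᵃ[ℝ] ℂ) (w : ι → ℝ) {v : ℂ}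
    (hv : v ∈ convexHull ℝ (Set.range fun j => P j w)) :
    τ.lenTstar w v ≤ τ.boundTstar P w := by
  refine add_le_add le_rfl (Finset.sum_le_sum fun x _ => ?_)
  obtain ⟨_, ⟨j, rfl⟩, hj⟩ := convexHull_exists_dist_ge hv (T.pos w x)
  rw [dist_comm, dist_comm (P j w)] at hj
  exact hj.trans (dist_le_iSup (fun j => P j w) (T.pos w x) j)

/-! ### The bounding constraint -/

theorem splittingFunction_le_onRegion {ρ : ℝ} {σ : ∀ w, Config T w → ℂ} {Ω : Set (ι → ℝ)}
    {g : (ι → ℝ) → ℝ} {w : ι → ℝ} {C : Config T w}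
    (h : w ∈ Ω → τ.Admissible C (σ w C) ∧
      ρ * τ.lenTstar w (σ w C) + τ.lenSplus w - τ.lenSminus w ≤ g w) :
    τ.splittingFunction ρ σ w C ≤ onRegion Ω g w := by
  by_cases hw : w ∈ Ω
  · obtain ⟨hadm, hle⟩ := h hw
    simp only [splittingFunction, onRegion, hw, hadm, if_true]
    exact_mod_cast hle
  · simp [onRegion, hw]

end Splitting

/-- The bounding constraint in the case of a trapped regular point. -/
theorem boundsSplitting_of_trapped {ι : Type*} {T : LocalTopology ι} {ρ : ℝ} (hρ : 0 ≤ ρ)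
    (τ : Splitting T) {Ω : Set (ι → ℝ)} {m : ℕ} (P : Fin (m + 1) → (ι → ℝ) →ᵃ[ℝ] ℂ)
    (htrap : TrappedRegularPointLemma T Ω P)
    (hadm : ∀ w ∈ paramSpace ι, w ∈ Ω → ∀ C : Config T w, ∀ v, C.IsImplicit v →
      τ.Admissible C v) :
    BoundsSplitting ρ τ
      (onRegion Ω fun w => ρ * τ.boundTstar P w + τ.lenSplus w - τ.lenSminus w) := by
  have hex : ∀ w, ∀ C : Config T w, ∃ v, w ∈ paramSpace ι → w ∈ Ω →
      C.IsImplicit v ∧ v ∈ convexHull ℝ (Set.range fun j => P j w) := by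
    intro w C
    by_cases hw : w ∈ paramSpace ι ∧ w ∈ Ω
    · obtain ⟨v, hv⟩ := htrap w hw.1 hw.2 C
      exact ⟨v, fun _ _ => hv⟩
    -- Off Ω the bound is +∞, so the chosen point is irrelevant.
    · exact ⟨0, fun h₁ h₂ => absurd ⟨h₁, h₂⟩ hw⟩
  choose σ hσ using hex
  refine ⟨σ, fun w hw C => τ.splittingFunction_le_onRegion fun hΩ => ?_⟩
  obtain ⟨himp, hhull⟩ := hσ w C hw hΩ
  refine ⟨hadm w hw hΩ C _ himp, ?_⟩
  have := mul_le_mul_of_nonneg_left (τ.lenTstar_le_boundTstar P w hhull) hρ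
  linarith

end SteinerVer

namespace SteinerVer

open EuclideanGeometry

/-! ### Valid four-point Steiner trees -/

/-- The dot product of two vectors of the plane. -/
def dot (u v : ℂ) : ℝ := u.re * v.re + u.im * v.im

theorem dot_mul_left (d u v : ℂ) : dot (d * u) (d * v) = Complex.normSq d * dot u v := by
  simp only [dot, Complex.normSq_apply, Complex.mul_re, Complex.mul_im]
  ring

theorem cross_mul_left (d u v : ℂ) : cross (d * u) (d * v) = Complex.normSq d * cross u v := by
  simp only [cross, Complex.normSq_apply, Complex.mul_re, Complex.mul_im]
  ring

theorem sqrt_three_sq : √3 * √3 = (3 : ℝ) := Real.mul_self_sqrt (by norm_num)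

theorem sqrt_three_pos : 0 < √(3 : ℝ) := Real.sqrt_pos.2 (by norm_num)

/-- The rotation by `60°`. -/
noncomputable def rot : ℂ := ⟨1 / 2, √3 / 2⟩

theorem apex_eq (A B : ℂ) : apex A B = A + (B - A) * rot := by
  have : Complex.exp ((Real.pi / 3 : ℝ) * Complex.I) = rot := by
    apply Complex.ext
    · rw [Complex.exp_ofReal_mul_I_re, Real.cos_pi_div_three]; rfl
    · rw [Complex.exp_ofReal_mul_I_im, Real.sin_pi_div_three]; rfl
  rw [apex, this]

theorem rot_sq : rot ^ 2 = rot - 1 := by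
  have := sqrt_three_sq
  apply Complex.ext <;> simp [rot, pow_two] <;> linarith

theorem norm_rot : ‖rot‖ = 1 := by
  have := sqrt_three_sq
  rw [← sq_eq_sq₀ (norm_nonneg _) zero_le_one, Complex.sq_norm, Complex.normSq_apply]
  simp only [rot]
  linarith

/-- This is cos ≥ -1/2 in polynomial form: with a negative dot product, squaring gives 4 dot² ≤ dot²
+ cross². -/
theorem nonneg_of_angle_le {X Y Z : ℂ} (h : ∠ X Y Z ≤ 2 * Real.pi / 3) :
    0 ≤ √3 * dot (X - Y) (Z - Y) + |cross (X - Y) (Z - Y)| := by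
  set x := X - Y
  set z := Z - Y
  have hcos : -(1 / 2) ≤ Real.cos (InnerProductGeometry.angle x z) := by
    have h23 : Real.cos (2 * Real.pi / 3) = -(1 / 2) := by
      rw [show 2 * Real.pi / 3 = Real.pi - Real.pi / 3 by ring, Real.cos_pi_sub,
        Real.cos_pi_div_three]
    rw [← h23]
    exact Real.cos_le_cos_of_nonneg_of_le_pi (InnerProductGeometry.angle_nonneg _ _)
      (by linarith [Real.pi_pos]) h
  have hdot : Real.cos (InnerProductGeometry.angle x z) * (‖x‖ * ‖z‖) = dot x z := by
    rw [InnerProductGeometry.cos_angle_mul_norm_mul_norm, Complex.inner]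
    simp only [dot, Complex.mul_re, Complex.conj_re, Complex.conj_im]
    ring
  have hprod : (‖x‖ * ‖z‖) ^ 2 = dot x z ^ 2 + cross x z ^ 2 := by
    rw [mul_pow, Complex.sq_norm, Complex.sq_norm, Complex.normSq_apply, Complex.normSq_apply, dot,
      cross]
    ring
  have hnn : 0 ≤ ‖x‖ * ‖z‖ := by positivity
  have hlow : -(‖x‖ * ‖z‖) ≤ 2 * dot x z := by
    have := mul_le_mul_of_nonneg_right hcos hnn
    linarith
  rcases le_total 0 (dot x z) with hd | hd
  · have := sqrt_three_pos
    positivity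
  · have hsq : (√3 * -dot x z) ^ 2 ≤ cross x z ^ 2 := by
      have h4 : (2 * -dot x z) ^ 2 ≤ (‖x‖ * ‖z‖) ^ 2 :=
        pow_le_pow_left₀ (by linarith) (by linarith) 2
      rw [mul_pow, pow_two √3, sqrt_three_sq]
      linarith
    have := (le_abs_self _).trans (sq_le_sq.1 hsq)
    linarith

/-- Algebraic core of `cross_apex_nonneg`, with u = A - O, v = B - O, X = u·(u - v), Y = v·(u - v)
and k = -u×v. If the apex were beyond AB, then tY > rX, and the triangle OAB would be obtuse at B (Y
> 0) or at A (X < 0). The angle from the apex at that same vertex would then exceed 120°, contrary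
to `h₂` or `h₁` respectively. -/
theorem nonneg_of_angle_bounds {X Y k r t : ℝ} (hXY : Y < X) (hk : 0 < k) (hr : 0 < r)
    (ht : 0 < t)
    (h₁ : 0 ≤ √3 * (X + (r * X + t * Y) / 2 + √3 / 2 * k * (t - r)) +
      |k * (2 + r + t) / 2 - √3 / 2 * (t * Y - r * X)|)
    (h₂ : 0 ≤ √3 * -(Y + (r * X + t * Y) / 2 + √3 / 2 * k * (t - r)) +
      |k * (2 + r + t) / 2 - √3 / 2 * (t * Y - r * X)|) :
    0 ≤ k * (2 + r + t) / 2 - √3 / 2 * (t * Y - r * X) := by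
  by_contra! hneg
  rw [abs_of_neg hneg] at h₁ h₂
  have hq := sqrt_three_pos
  have hq2 := sqrt_three_sq
  have hk2 : 0 < k * (2 + r + t) / 2 := by positivity
  have hpos : 0 < t * Y - r * X := by
    have : 0 < √3 / 2 * (t * Y - r * X) := by linarith
    exact pos_of_mul_pos_right this (by positivity)
  have hexp : √3 * (√3 / 2 * k * (t - r)) = 3 / 2 * (k * (t - r)) := by
    linear_combination (k * (t - r) / 2) * hq2
  rcases lt_or_ge 0 Y with hY | hY
  · have hrt : r < t := by
      have : r * Y < t * Y := by nlinarith [mul_lt_mul_of_pos_left hXY hr]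
      exact lt_of_mul_lt_mul_right this hY.le
    have e₁ : 0 < k * (t - r) := mul_pos hk (sub_pos.2 hrt)
    have e₂ : 0 < √3 * Y := mul_pos hq hY
    have e₃ : 0 < √3 * (r * X) := mul_pos hq (mul_pos hr (hY.trans hXY))
    linarith
  · have hX : X < 0 := by
      have : r * X < 0 := by nlinarith [mul_nonpos_of_nonneg_of_nonpos ht.le hY]
      exact neg_of_mul_neg_right this hr.le
    have hrt : t < r := by
      have : t * -X < r * -X := by nlinarith [mul_lt_mul_of_pos_left hXY ht]
      exact lt_of_mul_lt_mul_right this (by linarith)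
    have e₁ : 0 < k * (r - t) := mul_pos hk (sub_pos.2 hrt)
    have e₂ : 0 < √3 * -X := mul_pos hq (by linarith)
    have e₃ : 0 ≤ √3 * (t * -Y) := mul_nonneg hq.le (mul_nonneg ht.le (by linarith))
    linarith

/-- The apex of the triangle over `CD` lies on the same side of `AB` as the quadrilateral. -/
theorem cross_apex_nonneg {A B C D O : ℂ} {r t : ℝ} (hr : 0 < r) (ht : 0 < t)
    (hC : C - O = -(r : ℂ) * (A - O)) (hD : D - O = -(t : ℂ) * (B - O))
    (hO : cross (A - O) (B - O) < 0) (h₁ : ∠ (apex C D) A B ≤ 2 * Real.pi / 3)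
    (h₂ : ∠ (apex C D) B A ≤ 2 * Real.pi / 3) :
    0 ≤ cross (apex C D - A) (B - A) := by
  obtain ⟨u, rfl⟩ : ∃ u, A = O + u := ⟨A - O, by ring⟩
  obtain ⟨v, rfl⟩ : ∃ v, B = O + v := ⟨B - O, by ring⟩
  obtain rfl : C = O - r * u := by linear_combination hC
  obtain rfl : D = O - t * v := by linear_combination hD
  have g₁ := nonneg_of_angle_le h₁
  have g₂ := nonneg_of_angle_le h₂
  simp only [add_sub_cancel_left] at hO
  set V := apex (O - r * u) (O - t * v) with hV
  have hVre : V.re = O.re - r * u.re + (r * u.re - t * v.re) / 2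
      - √3 / 2 * (r * u.im - t * v.im) := by
    rw [hV, apex_eq]; simp [rot]; ring
  have hVim : V.im = O.im - r * u.im + (r * u.im - t * v.im) / 2
      + √3 / 2 * (r * u.re - t * v.re) := by
    rw [hV, apex_eq]; simp [rot]; ring
  have hlt : dot u v - dot v v < dot u u - dot u v := by
    have hne : 0 < (u.re - v.re) ^ 2 + (u.im - v.im) ^ 2 := by
      by_contra! hle
      have h0 : u.re - v.re = 0 := by nlinarith [sq_nonneg (u.re - v.re), sq_nonneg (u.im - v.im)]
      have h0' : u.im - v.im = 0 := by nlinarith [sq_nonneg (u.re - v.re), sq_nonneg (u.im - v.im)]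
      rw [cross, sub_eq_zero.1 h0, sub_eq_zero.1 h0', mul_comm, sub_self] at hO
      exact lt_irrefl _ hO
    simp only [dot]
    linarith
  have hc : cross (V - (O + u)) (O + v - (O + u)) = -cross u v * (2 + r + t) / 2 -
      √3 / 2 * (t * (dot u v - dot v v) - r * (dot u u - dot u v)) := by
    simp only [cross, dot, Complex.sub_re, Complex.sub_im, Complex.add_re, Complex.add_im, hVre,
      hVim]
    ring
  have hc' : cross (V - (O + v)) (O + u - (O + v)) =
      -cross (V - (O + u)) (O + v - (O + u)) := by
    simp only [cross, Complex.sub_re, Complex.sub_im, Complex.add_re, Complex.add_im]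
    ring
  rw [hc', abs_neg] at g₂
  rw [hc] at g₁ g₂ ⊢
  refine nonneg_of_angle_bounds hlt (neg_pos.2 hO) hr ht ?_ ?_
  · convert g₁ using 3
    simp only [cross, dot, Complex.sub_re, Complex.sub_im, Complex.add_re, Complex.add_im, hVre,
      hVim]
    ring
  · convert g₂ using 3
    simp only [cross, dot, Complex.sub_re, Complex.sub_im, Complex.add_re, Complex.add_im, hVre,
      hVim]
    ring

/-- Simpson's construction of the Steiner point on the line from the apex `U` over `AB`
towards `V`. -/
theorem exists_simpson_point {A B V : ℂ} (hne : V ≠ apex A B)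
    (hc : 0 ≤ cross (V - A) (B - A))
    (h₁ : ∠ V A B ≤ 2 * Real.pi / 3) (h₂ : ∠ V B A ≤ 2 * Real.pi / 3) :
    ∃ (S : ℂ) (α β : ℝ), 0 ≤ α ∧ 0 ≤ β ∧
      A = S - α * ((V - apex A B) / (‖V - apex A B‖ : ℂ)) * rot ∧
      B = S + β * ((V - apex A B) / (‖V - apex A B‖ : ℂ)) * (rot - 1) ∧
      apex A B = S - (α + β) * ((V - apex A B) / (‖V - apex A B‖ : ℂ)) := by
  have hq := sqrt_three_pos
  have g₁ := nonneg_of_angle_le h₁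
  have g₂ := nonneg_of_angle_le h₂
  have hc' : cross (V - B) (A - B) = -cross (V - A) (B - A) := by
    simp only [cross, Complex.sub_re, Complex.sub_im]
    ring
  rw [hc', abs_neg] at g₂
  rw [abs_of_nonneg hc] at g₁ g₂
  set p := √3 * dot (V - A) (B - A) + cross (V - A) (B - A) with hp
  set p' := √3 * dot (V - B) (A - B) + cross (V - A) (B - A) with hp'
  set W := V - apex A B with hW
  have hV : V = W + (A + (B - A) * rot) := by rw [hW, apex_eq]; ring
  have hWn : 0 < ‖W‖ := norm_pos_iff.2 (sub_ne_zero.2 hne)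
  -- Passing from V - A to W leaves the form unchanged: the two terms in |B - A|² cancel, because
  -- the apex is a 60° rotation.
  have hp2 : p = √3 * dot W (B - A) + cross W (B - A) := by
    rw [hp, hV]
    simp only [dot, cross, rot, Complex.sub_re, Complex.sub_im, Complex.add_re, Complex.add_im,
      Complex.mul_re, Complex.mul_im]
    ring
  have hp2' : p' = -(√3 * dot W (B - A)) + cross W (B - A) := by
    rw [hp', hV]
    simp only [dot, cross, rot, Complex.sub_re, Complex.sub_im, Complex.add_re, Complex.add_im,
      Complex.mul_re, Complex.mul_im]
    ring
  -- Up to scale, `p` and `p'` are the coordinates of B - A in the directions at 60° and 120° to W.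
  -- The angle conditions make them nonnegative, so they serve as edge lengths.
  have key : (√3 : ℂ) * (‖W‖ : ℂ) ^ 2 * (B - A) = W * (p * rot + p' * (rot - 1)) := by
    have hN : (‖W‖ : ℂ) ^ 2 = ((W.re * W.re + W.im * W.im : ℝ) : ℂ) := by
      rw [← Complex.normSq_apply, ← Complex.sq_norm]; push_cast; ring
    rw [hN, hp2, hp2']
    apply Complex.ext <;>
    · simp [dot, cross, rot]
      ring
  have hl : (‖W‖ : ℂ) ≠ 0 := by exact_mod_cast hWn.ne'
  have hqc : (√3 : ℂ) ≠ 0 := by exact_mod_cast hq.ne'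
  have hB : B - A = (p / (√3 * ‖W‖) : ℝ) * (W / ‖W‖) * rot +
      (p' / (√3 * ‖W‖) : ℝ) * (W / ‖W‖) * (rot - 1) := by
    push_cast
    field_simp
    linear_combination key
  have hrs := rot_sq
  refine ⟨A + (p / (√3 * ‖W‖) : ℝ) * (W / ‖W‖) * rot, p / (√3 * ‖W‖), p' / (√3 * ‖W‖),
    by positivity, by positivity, by ring, by linear_combination hB, ?_⟩
  rw [apex_eq, hB]
  linear_combination ((p / (√3 * ‖W‖) : ℝ) * (W / ‖W‖) + (p' / (√3 * ‖W‖) : ℝ) * (W / ‖W‖)) * hrs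

/-- Strict convexity forces O to be interior to both diagonals; `r` and `t` are the ratios |OC|/|OA|
and |OD|/|OB|. -/
theorem ValidFourPoint.exists_diagonals {A B C D : ℂ} (h : ValidFourPoint A B C D) :
    ∃ (O : ℂ) (r t : ℝ), 0 < r ∧ 0 < t ∧ C - O = -(r : ℂ) * (A - O) ∧
      D - O = -(t : ℂ) * (B - O) ∧ cross (A - O) (B - O) < 0 ∧ ∠ A O B ≤ 2 * Real.pi / 3 := by
  obtain ⟨O, ⟨⟨μ', μ, hμ', hμ, hμs, hO⟩, ⟨ν', ν, hν', hν, hνs, hO'⟩⟩, hang⟩ := h.angle_diagonals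
  obtain ⟨c₁, c₂, c₃, c₄⟩ := h.convex
  have e₁ : μ' = 1 - μ := by linarith
  have e₂ : ν' = 1 - ν := by linarith
  subst e₁ e₂
  have hre : (1 - μ) * A.re + μ * C.re = (1 - ν) * B.re + ν * D.re := by
    simpa using congrArg Complex.re (hO.trans hO'.symm)
  have him : (1 - μ) * A.im + μ * C.im = (1 - ν) * B.im + ν * D.im := by
    simpa using congrArg Complex.im (hO.trans hO'.symm)
  simp only [cross, Complex.sub_re, Complex.sub_im] at c₁ c₂ c₃ c₄
  -- With μ = 0 the vertex A would lie on BD, making the turn at A degenerate. The other three cases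
  -- are analogous.
  have hμ0 : 0 < μ := lt_of_le_of_ne hμ <| by
    rintro rfl
    rw [show A.re = (1 - ν) * B.re + ν * D.re by linarith,
      show A.im = (1 - ν) * B.im + ν * D.im by linarith] at c₄
    linarith
  have hμ1 : 0 < 1 - μ := lt_of_le_of_ne hμ' <| fun h0 => by
    obtain rfl : μ = 1 := by linarith
    rw [show C.re = (1 - ν) * B.re + ν * D.re by linarith,
      show C.im = (1 - ν) * B.im + ν * D.im by linarith] at c₂
    linarith
  have hν0 : 0 < ν := lt_of_le_of_ne hν <| by
    rintro rfl
    rw [show B.re = (1 - μ) * A.re + μ * C.re by linarith,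
      show B.im = (1 - μ) * A.im + μ * C.im by linarith] at c₁
    linarith
  have hν1 : 0 < 1 - ν := lt_of_le_of_ne hν' <| fun h0 => by
    obtain rfl : ν = 1 := by linarith
    rw [show D.re = (1 - μ) * A.re + μ * C.re by linarith,
      show D.im = (1 - μ) * A.im + μ * C.im by linarith] at c₃
    linarith
  simp only [Complex.real_smul, Complex.ofReal_sub, Complex.ofReal_one] at hO hO'
  have hμc : (μ : ℂ) ≠ 0 := by exact_mod_cast hμ0.ne'
  have hνc : (ν : ℂ) ≠ 0 := by exact_mod_cast hν0.ne'
  have hAO : A - O = (μ : ℂ) * (A - C) := by rw [← hO]; ring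
  have hBO : B - O = (ν : ℂ) * (B - D) := by rw [← hO']; ring
  refine ⟨O, (1 - μ) / μ, (1 - ν) / ν, div_pos hμ1 hμ0, div_pos hν1 hν0, ?_, ?_, ?_, hang⟩
  · rw [hAO, ← hO]
    push_cast
    field_simp
    ring
  · rw [hBO, ← hO']
    push_cast
    field_simp
    ring
  · have hdiag : cross (A - C) (B - D) < 0 := by
      simp only [cross, Complex.sub_re, Complex.sub_im]
      linarith
    have hprod : cross (A - O) (B - O) = μ * ν * cross (A - C) (B - D) := by
      rw [hAO, hBO]
      simp only [cross, Complex.re_ofReal_mul, Complex.im_ofReal_mul]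
      ring
    rw [hprod]
    exact mul_neg_of_pos_of_neg (mul_pos hμ0 hν0) hdiag

/-- A negative ε would satisfy -ε ≥ p + q by `hang`, and then ε(p + q) + pq ≤ pq - (p + q)² ≤ 0. -/
theorem nonneg_of_diagonal_angle {ε p q : ℝ} (hp : 0 ≤ p) (hq : 0 ≤ q)
    (harea : 0 < ε * (p + q) + p * q) (hang : 0 ≤ ε * (ε + (p + q))) : 0 ≤ ε := by
  by_contra! hε
  have h : ε + (p + q) ≤ 0 := by
    by_contra! hcon
    exact absurd hang (not_le.2 (mul_neg_of_neg_of_pos hε hcon))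
  nlinarith [mul_nonneg (add_nonneg hp hq) (neg_nonneg.2 h), mul_nonneg hp hq, sq_nonneg p,
    sq_nonneg q]

/-- A valid four-point tree has total length `|UV|`. -/
theorem ValidFourPoint.exists_steiner_points {A B C D : ℂ} (h : ValidFourPoint A B C D) :
    ∃ S₁ S₂ : ℂ, dist A S₁ + dist B S₁ + dist S₁ S₂ + dist S₂ C + dist S₂ D =
      dist (apex A B) (apex C D) := by
  obtain ⟨O, r, t, hr, ht, hC, hD, hO, hang⟩ := h.exists_diagonals
  have hrc : (r : ℂ) ≠ 0 := by exact_mod_cast hr.ne'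
  have htc : (t : ℂ) ≠ 0 := by exact_mod_cast ht.ne'
  have hV := cross_apex_nonneg hr ht hC hD hO h.angle_VAB h.angle_VBA
  have hOCD : cross (C - O) (D - O) < 0 := by
    have : cross (C - O) (D - O) = r * t * cross (A - O) (B - O) := by
      rw [hC, hD]
      simp only [cross, neg_mul, Complex.neg_re, Complex.neg_im, Complex.re_ofReal_mul,
        Complex.im_ofReal_mul]
      ring
    rw [this]
    exact mul_neg_of_pos_of_neg (mul_pos hr ht) hO
  -- The same lemma with the pairs AB and CD exchanged, which inverts both ratios.
  have hU : 0 ≤ cross (apex A B - C) (D - C) :=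
    cross_apex_nonneg (O := O) (inv_pos.2 hr) (inv_pos.2 ht)
      (by rw [hC]; push_cast; field_simp) (by rw [hD]; push_cast; field_simp) hOCD
      h.angle_UCD h.angle_UDC
  -- The apex over AB lies strictly on the outer side of AB, while the apex over CD does not.
  have hne : apex C D ≠ apex A B := by
    intro heq
    have hAB : cross (apex A B - A) (B - A) = -(√3 / 2) * dot (B - A) (B - A) := by
      rw [apex_eq]
      simp [cross, dot, rot]
      ring
    rw [heq, hAB] at hV
    have hq := sqrt_three_pos
    have hd : dot (B - A) (B - A) ≤ 0 := by
      by_contra! hpos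
      nlinarith [mul_pos hq hpos]
    simp only [dot] at hd
    have h1 : (B - A).re = 0 := by nlinarith [sq_nonneg (B - A).re, sq_nonneg (B - A).im]
    have h2 : (B - A).im = 0 := by nlinarith [sq_nonneg (B - A).re, sq_nonneg (B - A).im]
    have h3 := h.convex.1
    rw [cross, h1, h2] at h3
    linarith
  obtain ⟨S₁, α, β, hα, hβ, hA, hB, hU'⟩ :=
    exists_simpson_point hne hV h.angle_VAB h.angle_VBA
  obtain ⟨S₂, γ, δ, hγ, hδ, hC', hD', hV'⟩ :=
    exists_simpson_point hne.symm hU h.angle_UCD h.angle_UDC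
  rw [← neg_sub (apex C D) (apex A B), norm_neg, neg_div] at hC' hD' hV'
  set W := apex C D - apex A B with hW
  have hl : 0 < ‖W‖ := norm_pos_iff.2 (sub_ne_zero.2 hne)
  have hlc : (‖W‖ : ℂ) ≠ 0 := by exact_mod_cast hl.ne'
  set d := W / (‖W‖ : ℂ) with hd
  have hdn : ‖d‖ = 1 := by
    rw [hd, norm_div, Complex.norm_real, norm_norm, div_self hl.ne']
  have hWd : W = ‖W‖ * d := by rw [hd]; field_simp
  -- The signed distance from S₁ to S₂ in the direction d from U to V; it is a length only once
  -- shown nonnegative.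
  set ε : ℝ := ‖W‖ - α - β - γ - δ with hε
  have hS : S₂ - S₁ = ε * d := by
    rw [hε]
    push_cast
    linear_combination hW.symm.trans hWd - hV' + hU'
  have hCA : C - A = d * (ε + (α + γ : ℝ) * rot) := by
    push_cast
    linear_combination hC' - hA + hS
  have hDB : D - B = d * (ε + (β + δ : ℝ) * (1 - rot)) := by
    push_cast
    linear_combination hD' - hB + hS
  have hnd : Complex.normSq d = 1 := by rw [← Complex.sq_norm, hdn, one_pow]
  have hεnn : 0 ≤ ε := by
    -- With p = α + γ and q = β + δ, convexity reads ε(p + q) + pq > 0, and the 120° bound on the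
    -- diagonals reads ε(ε + p + q) ≥ 0.
    have hcr : cross (C - A) (D - B) =
        -(√3 / 2) * (ε * ((α + γ) + (β + δ)) + (α + γ) * (β + δ)) := by
      rw [hCA, hDB, cross_mul_left, hnd]
      simp [cross, rot]
      ring
    have hdt : dot (C - A) (D - B) =
        ε ^ 2 + ε * ((α + γ) + (β + δ)) / 2 - (α + γ) * (β + δ) / 2 := by
      rw [hCA, hDB, dot_mul_left, hnd]
      simp [dot, rot]
      linear_combination (-(α + γ) * (β + δ) / 4) * sqrt_three_sq
    have hq := sqrt_three_pos
    have hCA' : C - A = -((1 + r : ℝ) : ℂ) * (A - O) := by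
      push_cast; linear_combination hC
    have hDB' : D - B = -((1 + t : ℝ) : ℂ) * (B - O) := by
      push_cast; linear_combination hD
    have hcO : cross (C - A) (D - B) = (1 + r) * (1 + t) * cross (A - O) (B - O) := by
      rw [hCA', hDB']
      simp only [cross, neg_mul, Complex.neg_re, Complex.neg_im, Complex.re_ofReal_mul,
        Complex.im_ofReal_mul]
      ring
    have hdO : dot (C - A) (D - B) = (1 + r) * (1 + t) * dot (A - O) (B - O) := by
      rw [hCA', hDB']
      simp only [dot, neg_mul, Complex.neg_re, Complex.neg_im, Complex.re_ofReal_mul,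
        Complex.im_ofReal_mul]
      ring
    have hrt : 0 < (1 + r) * (1 + t) := by positivity
    have hneg : cross (C - A) (D - B) < 0 := hcO ▸ mul_neg_of_pos_of_neg hrt hO
    have hang' : 0 ≤ √3 * dot (C - A) (D - B) - cross (C - A) (D - B) := by
      have := nonneg_of_angle_le hang
      rw [abs_of_neg hO] at this
      rw [hcO, hdO]
      linarith [mul_nonneg hrt.le this]
    refine nonneg_of_diagonal_angle (add_nonneg hα hγ) (add_nonneg hβ hδ) ?_ ?_
    · rw [hcr] at hneg
      have : 0 < √3 / 2 * (ε * ((α + γ) + (β + δ)) + (α + γ) * (β + δ)) := by linarith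
      exact pos_of_mul_pos_right this (by positivity)
    · rw [hcr, hdt] at hang'
      have : 0 ≤ √3 * (ε * (ε + ((α + γ) + (β + δ)))) := by linarith
      exact nonneg_of_mul_nonneg_right this hq
  have hrot1 : ‖rot - 1‖ = 1 := by rw [← rot_sq, norm_pow, norm_rot, one_pow]
  refine ⟨S₁, S₂, ?_⟩
  have d₁ : dist A S₁ = α := by
    rw [dist_eq_norm, show A - S₁ = -(α * d * rot) by linear_combination hA, norm_neg, norm_mul,
      norm_mul, hdn, norm_rot, Complex.norm_real, Real.norm_of_nonneg hα, mul_one, mul_one]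
  have d₂ : dist B S₁ = β := by
    rw [dist_eq_norm, show B - S₁ = β * d * (rot - 1) by linear_combination hB, norm_mul,
      norm_mul, hdn, hrot1, Complex.norm_real, Real.norm_of_nonneg hβ, mul_one, mul_one]
  have d₃ : dist S₁ S₂ = ε := by
    rw [dist_comm, dist_eq_norm, hS, norm_mul, hdn, Complex.norm_real, Real.norm_of_nonneg hεnn,
      mul_one]
  have d₄ : dist S₂ C = γ := by
    rw [dist_eq_norm, show S₂ - C = -(γ * d * rot) by linear_combination -hC', norm_neg, norm_mul,
      norm_mul, hdn, norm_rot, Complex.norm_real, Real.norm_of_nonneg hγ, mul_one, mul_one]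
  have d₅ : dist S₂ D = δ := by
    rw [dist_eq_norm, show S₂ - D = δ * d * (rot - 1) by linear_combination -hD', norm_mul,
      norm_mul, hdn, hrot1, Complex.norm_real, Real.norm_of_nonneg hδ, mul_one, mul_one]
  rw [d₁, d₂, d₃, d₄, d₅, dist_comm, dist_eq_norm, ← hW, hε]
  ring

/-! ### The four-point tree inside S⁺ -/

namespace Splitting

variable {ι : Type*} {T : LocalTopology ι} (τ : Splitting T)

theorem sum_insert_le {α : Type*} [DecidableEq α] {f : α → ℝ} (hf : ∀ x, 0 ≤ f x) (x : α)
    (s : Finset α) : ∑ y ∈ insert x s, f y ≤ f x + ∑ y ∈ s, f y := by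
  by_cases hx : x ∈ s
  · rw [Finset.insert_eq_of_mem hx]
    linarith [hf x]
  · rw [Finset.sum_insert hx]

/-- Only an inequality, since listed edges may coincide as set elements when nodes repeat. -/
theorem sum_fourPointTree_le {k : ℕ} (X : Fin 4 → T.Node) (a b : Fin k)
    {f : Sym2 (T.Node ⊕ Fin k) → ℝ} (hf : ∀ e, 0 ≤ f e) :
    ∑ e ∈ fourPointTree X a b, f e ≤ f s(.inl (X 0), .inr a) + (f s(.inl (X 1), .inr a) +
      (f s(.inr a, .inr b) + (f s(.inr b, .inl (X 2)) + f s(.inr b, .inl (X 3))))) := by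
  unfold fourPointTree
  refine (sum_insert_le hf _ _).trans (add_le_add le_rfl ?_)
  refine (sum_insert_le hf _ _).trans (add_le_add le_rfl ?_)
  refine (sum_insert_le hf _ _).trans (add_le_add le_rfl ?_)
  refine (sum_insert_le hf _ _).trans (add_le_add le_rfl ?_)
  rw [Finset.sum_singleton]

theorem lenSplus_le_boundSplus {X : Fin 4 → T.Node} {a b : Fin τ.aux}
    (hinc : τ.IncludesFourPointTree X a b) {w : ι → ℝ}
    (hvalid : ValidFourPoint (T.pos w (X 0)) (T.pos w (X 1)) (T.pos w (X 2)) (T.pos w (X 3))) :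
    τ.lenSplus w ≤ τ.boundSplus X a b w := by
  obtain ⟨S₁, S₂, hS⟩ := hvalid.exists_steiner_points
  rw [boundSplus, ← hS, ← sub_le_iff_le_add']
  refine le_ciInf fun q => ?_
  rw [sub_le_iff_le_add']
  -- Only `a` and `b` are moved, to the points realizing |UV|. All edges outside the four-point tree
  -- avoid them and keep their lengths.
  set q' : Fin τ.aux → ℂ := Function.update (Function.update q a S₁) b S₂ with hq'
  have ha : q' a = S₁ := by simp [hq', hinc.ne]
  have hb : q' b = S₂ := by simp [hq']
  refine (steinerLen_le τ.Splus w q').trans ?_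
  rw [← Finset.sum_sdiff hinc.subset, add_comm]
  refine add_le_add ?_ (Finset.sum_le_sum fun e he => le_of_eq ?_)
  · refine (sum_fourPointTree_le X a b
      (f := fun e => edgeLen (e.map (Sum.elim (T.pos w) q'))) fun e => edgeLen_nonneg _).trans ?_
    simp only [Sym2.map_mk, edgeLen_mk, Sum.elim_inl, Sum.elim_inr, ha, hb]
    linarith
  · rw [Finset.mem_sdiff] at he
    refine congrArg edgeLen (Sym2.map_congr fun x hx => ?_)
    rcases x with x | i
    · rfl
    · have hia : i ≠ a := by
        rintro rfl
        exact he.2 (hinc.only e he.1 (Or.inl hx))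
      have hib : i ≠ b := by
        rintro rfl
        exact he.2 (hinc.only e he.1 (Or.inr hx))
      simp [hq', hia, hib]

/-- Each apex is a fixed complex-linear combination of two nodes, hence affine in `w`, which makes
|UV| convex. This is the advantage of |UV| as an explicit formula. -/
theorem convexOn_boundSplus (X : Fin 4 → T.Node) (a b : Fin τ.aux) :
    ConvexOn ℝ (paramSpace ι) (τ.boundSplus X a b) := by
  refine ConvexOn.add ⟨convex_paramSpace ι, fun v _ w _ r t hr ht hrt => ?_⟩
    (convexOn_steinerLen _)
  have hcombo : ∀ x y : T.Node, apex (T.pos (r • v + t • w) x) (T.pos (r • v + t • w) y) =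
      r • apex (T.pos v x) (T.pos v y) + t • apex (T.pos w x) (T.pos w y) := by
    intro x y
    simp only [T.pos_combo v w hrt, apex, Complex.real_smul]
    ring
  simp only [hcombo]
  refine (dist_add_add_le _ _ _ _).trans (le_of_eq ?_)
  rw [dist_smul₀, dist_smul₀, Real.norm_of_nonneg hr, Real.norm_of_nonneg ht, smul_eq_mul,
    smul_eq_mul]

end Splitting

/-- The bounding constraint in the case of a valid four-point tree. -/
theorem boundsSplitting_of_validFourPoint {ι : Type*} {T : LocalTopology ι} {ρ : ℝ}
    (τ : Splitting T) {Ω : Set (ι → ℝ)} {X : Fin 4 → T.Node} {a b : Fin τ.aux}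
    (hvalid : ValidFourPointLemma T Ω X) (himp : τ.tImplicit = ∅)
    (hinc : τ.IncludesFourPointTree X a b)
    (hadm : ∀ w ∈ paramSpace ι, w ∈ Ω → ∀ C : Config T w, ∀ v, τ.Admissible C v) :
    BoundsSplitting ρ τ
      (onRegion Ω fun w => ρ * τ.lenExplicit w + τ.boundSplus X a b w - τ.lenSminus w) := by
  -- The point 0 is a dummy: without implicit edges it does not enter t*.
  refine ⟨fun _ _ => 0, fun w hw C => τ.splittingFunction_le_onRegion fun hΩ =>
    ⟨hadm w hw hΩ C _, ?_⟩⟩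
  have hle := τ.lenSplus_le_boundSplus hinc (hvalid w hw hΩ ⟨C⟩)
  have ht : τ.lenTstar w 0 = τ.lenExplicit w := by simp [Splitting.lenTstar, himp]
  rw [ht]
  linarith

end SteinerVer

theorem mainTheorem7 {ι : Type*} [Fintype ι] [DecidableEq ι] (T : LocalTopology ι)
    (ρ : ℝ) (hρ : 0 ≤ ρ) (τ : Splitting T) :
    (∀ (c : LinearConstraints ι) (m : ℕ) (P : Fin (m + 1) → (ι → ℝ) →ᵃ[ℝ] ℂ),
      TrappedRegularPointLemma T c.region P →
      (∀ w ∈ paramSpace ι, w ∈ c.region → ∀ C : Config T w, ∀ v, C.IsImplicit v →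
        τ.Admissible C v) →
      IsVerificationFunction T ρ
          (onRegion c.region fun w => ρ * τ.boundTstar P w + τ.lenSplus w - τ.lenSminus w) ∧
        BoundsSplitting ρ τ
          (onRegion c.region fun w => ρ * τ.boundTstar P w + τ.lenSplus w - τ.lenSminus w)) ∧
    (∀ (Ω : Set (ι → ℝ)) (X : Fin 4 → T.Node) (a b : Fin τ.aux),
      OrthConvex Ω → ValidFourPointLemma T Ω X →
      τ.tImplicit = ∅ → τ.IncludesFourPointTree X a b →
      (∀ w ∈ paramSpace ι, w ∈ Ω → ∀ C : Config T w, ∀ v, τ.Admissible C v) →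
      IsVerificationFunction T ρ
          (onRegion Ω fun w => ρ * τ.lenExplicit w + τ.boundSplus X a b w - τ.lenSminus w) ∧
        BoundsSplitting ρ τ
          (onRegion Ω fun w => ρ * τ.lenExplicit w + τ.boundSplus X a b w - τ.lenSminus w)) := by
  refine ⟨fun c m P htrap hadm => ?_, fun Ω X a b hΩ hvalid himp hinc hadm => ?_⟩
  · have hbound := boundsSplitting_of_trapped hρ τ P htrap hadm
    refine ⟨⟨shapeConstraint_onRegion c.orthConvex_region ?_, τ, hbound⟩, hbound⟩
    exact (((τ.convexOn_boundTstar P).smul hρ).add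
      (Splitting.convexOn_steinerLen τ.Splus)).sub τ.concaveOn_lenSminus
  · have hbound := boundsSplitting_of_validFourPoint (ρ := ρ) τ hvalid himp hinc hadm
    refine ⟨⟨shapeConstraint_onRegion hΩ ?_, τ, hbound⟩, hbound⟩
    exact ((τ.convexOn_lenExplicit.smul hρ).add
      (τ.convexOn_boundSplus X a b)).sub τ.concaveOn_lenSminus
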